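/- Let $m$ be Lebesgue measure on $[0,1]$. Let $r_k(t)=\operatorname{sign}\sin(2^k\pi t)$, $k\ge 1$, be the Rademacher functions, and let $(w_n)_{n\ge 0}$ be the Walsh system in Paley's numbering: $w_n=\prod_{i\in I} r_{i+1}$ where $n=\sum_{i\in I}2^i$ with $I\subset\{0,1,2,\dots\}$ finite (so $w_0=1$). For $q>1$, a sequence $(w_{n_k})_{k\ge1}$ with positive integers $n_k$ is called $q$-lacunary if $n_{k+1}/n_k\ge q$ for all $k\ge 1$. Let $M_2(t)=\exp(t^2)-1$ and, for measurable $f$ on $[0,1]$, let $\|f\|_{L^{M_2}}=\inf\{\lambda>0:\int_0^1 M_2(|f|/\lambda)\,dm\le 1\}$ (with value $\infty$ if there is no such $\lambda$). For a measurable set $E\subset[0,1]$ with $m(E)>0$ put $\rho_E(x)=m(E\cap[0,x])/m(E)$, let $\rho_E^{-1}(t)=\inf\{x\in[0,1]:\rho_E(x)\ge t\}$ be its left-continuous inverse, and let $\|f\|_{L^{M_2}|E}=\|f\circ\rho_E^{-1}\|_{L^{M_2}}$. For every $q>1$ there exist constants $A'=A'(M_2,q)>0$ and $B'=B'(M_2,q)>0$,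 depending only on $q$, such that for every measurable set $E\subset[0,1]$ with $m(E)>0$ there is an $N$ (depending on $E$ and $q$) such that for every $q$-lacunary sequence $(w_{n_k})_{k\ge1}$ of Walsh functions with $n_k\ge N$ for all $k\ge1$ and every real sequence $(a_k)_{k\ge1}\in\ell^2$, the series $\sum_{k\ge1}a_kw_{n_k}$ converges unconditionally in $L^2([0,1])$ and its sum satisfies $$A'\Big(\sum_{k=1}^\infty a_k^2\Big)^{1/2}\le\Big\|\sum_{k\ge1}a_kw_{n_k}\Big\|_{L^{M_2}|E}\le B'\Big(\sum_{k=1}^\infty a_k^2\Big)^{1/2}.$$ -/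

import Mathlib

open MeasureTheory
open scoped ENNReal

noncomputable section

/-- The Rademacher function `r_k(t) = sign (sin (2^k π t))`, used for `k ≥ 1`, `t ∈ [0,1]`. -/
def rademacher (k : ℕ) (t : ℝ) : ℝ := Real.sign (Real.sin (2 ^ k * Real.pi * t))

/-- The `k`-th Walsh function in Paley's numbering: if `k = ∑ 2^i` over the positions `i` of the
binary digits `1` of `k`, then `w_k = ∏ r_{i+1}` over the same `i`; in particular `w_0 = 1`. -/
def walsh (k : ℕ) (t : ℝ) : ℝ := ∏ i ∈ k.bitIndices.toFinset, rademacher (i + 1) t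

/-- Lebesgue measure on `[0,1]`. -/
def unitMeasure : Measure ℝ := volume.restrict (Set.Icc 0 1)

lemma measurable_rademacher (k : ℕ) : Measurable (rademacher k) := by
  have hs : Measurable Real.sign := by
    unfold Real.sign
    exact Measurable.ite measurableSet_Iio measurable_const
      (Measurable.ite measurableSet_Ioi measurable_const measurable_const)
  exact hs.comp (by fun_prop)

lemma measurable_walsh (k : ℕ) : Measurable (walsh k) := by
  unfold walsh
  exact Finset.measurable_fun_prod _ fun i _ => measurable_rademacher (i + 1)

lemma abs_rademacher_le_one (k : ℕ) (t : ℝ) : |rademacher k t| ≤ 1 := by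
  unfold rademacher
  rcases Real.sign_apply_eq (Real.sin (2 ^ k * Real.pi * t)) with h | h | h <;> simp [h]

lemma abs_walsh_le_one (k : ℕ) (t : ℝ) : |walsh k t| ≤ 1 := by
  unfold walsh
  rw [Finset.abs_prod]
  exact Finset.prod_le_one (fun _ _ => abs_nonneg _) fun i _ => abs_rademacher_le_one (i + 1) t

lemma memLp_walsh (k : ℕ) : MemLp (walsh k) 2 unitMeasure := by
  have : IsFiniteMeasure unitMeasure := by unfold unitMeasure; infer_instance
  exact MemLp.of_bound (measurable_walsh k).aestronglyMeasurable 1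
    (Filter.Eventually.of_forall fun t => abs_walsh_le_one k t)

/-- The Walsh function `w_k` as an element of `L²([0,1])`. -/
def walshLp (k : ℕ) : Lp ℝ 2 unitMeasure := (memLp_walsh k).toLp (walsh k)

/-- The sequence `(w_{n_k})` of Walsh functions is `q`-lacunary: the indices are positive and
`n_{k+1} / n_k ≥ q` for all `k`. -/
def IsLacunary (q : ℝ) (n : ℕ → ℕ) : Prop :=
  ∀ k, 0 < n k ∧ q ≤ (n (k + 1) : ℝ) / (n k : ℝ)

/-- The Luxemburg norm
`‖f‖_{L^Φ} = inf {c > 0 : ∫_0^1 Φ(|f|/c) dm ≤ 1}` of a measurable function on `[0,1]`.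
It takes values in `[0,∞]`, and is `∞` (the infimum of the empty set) exactly when the measurable
function `f` does not belong to the Orlicz space `L^Φ`. -/
def orliczNorm (Φ : ℝ → ℝ) (f : ℝ → ℝ) : ℝ≥0∞ :=
  ⨅ (c : ℝ) (_ : 0 < c ∧ ∫⁻ t, ENNReal.ofReal (Φ (|f t| / c)) ∂unitMeasure ≤ 1), ENNReal.ofReal c

/-- The Young function `M₂(t) = exp(t²) - 1`. -/
def youngM2 (t : ℝ) : ℝ := Real.exp (t ^ 2) - 1

/-- The map `ρ_E(x) = m(E ∩ [0,x]) / m(E)`. -/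
def rhoE (E : Set ℝ) (x : ℝ) : ℝ := volume.real (E ∩ Set.Icc 0 x) / volume.real E

/-- The left-continuous inverse `ρ_E⁻¹(t) = inf {x ∈ [0,1] : ρ_E(x) ≥ t}` of the increasing
function `ρ_E`, for `t ∈ [0,1]`. -/
def rhoEInv (E : Set ℝ) (t : ℝ) : ℝ := sInf {x | x ∈ Set.Icc (0 : ℝ) 1 ∧ t ≤ rhoE E x}

/-- The norm `‖f‖_{X|E} = ‖f ∘ ρ_E⁻¹‖_X` of the local space `X|E`, where `X` is given by its norm
(with value `∞` outside `X`). Since `ρ_E⁻¹(t) ∈ E` for almost every `t`, only the values of `f`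
on `E` matter. -/
def localNorm (X : (ℝ → ℝ) → ℝ≥0∞) (E : Set ℝ) (f : ℝ → ℝ) : ℝ≥0∞ := X (f ∘ rhoEInv E)

end

/-! Almost everywhere, products of Walsh functions correspond to symmetric differences of their sets
of binary positions, so integrals over `E` of such products are Walsh coefficients of the indicator
of `E`. By Bessel these are square summable, and those carrying a high position have total square
sum at most any prescribed `δ` (`exists_walsh_tail`). This smallness makes a lacunary system of high
frequencies behave on `E` almost as on `[0,1]`.

Lower bound: since `t ^ 2 ≤ exp (t ^ 2) - 1`, an `L²(E)` bound suffices. Expanding the square leaves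
`m(E) ∑ a_k²` plus off-diagonal terms. Lacunarity forces a high position in every symmetric
difference and lets each one occur at most `M` times, with `M` depending only on `q`. Cauchy–Schwarz
then absorbs the off-diagonal part (`IsLacunary.le_setIntegral_sq`).

Upper bound: along each residue class mod `M` the top binary positions strictly increase, so the
exponential of a finite sum is a Riesz product. Its constant term gives the main contribution; the
other Walsh terms all carry high positions, and Cauchy–Schwarz against the small coefficients bounds
them. Convexity recombines the classes (`IsLacunary.setIntegral_exp_le`), and integrating the
resulting subgaussian bound against a Gaussian gives the exponential square moment
(`lintegral_youngM2_le_of_exp_le`).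

Both bounds pass to the series, by continuity of restriction in `L²` and by Fatou, and reach the
local norm because `ρ_E⁻¹` carries Lebesgue measure to normalized measure on `E` (`map_rhoEInv`). -/

/-! ### Walsh functions indexed by finite sets; orthonormality and Bessel tails. -/

/-- The Walsh function attached to a finite set of binary positions. -/
noncomputable def walshSet (I : Finset ℕ) (t : ℝ) : ℝ := ∏ i ∈ I, rademacher (i + 1) t

lemma walsh_eq_walshSet (k : ℕ) : walsh k = walshSet k.bitIndices.toFinset := rfl

lemma measurable_walshSet (I : Finset ℕ) : Measurable (walshSet I) :=
  Finset.measurable_fun_prod _ fun i _ => measurable_rademacher (i + 1)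

lemma abs_walshSet_le_one (I : Finset ℕ) (t : ℝ) : |walshSet I t| ≤ 1 := by
  unfold walshSet
  rw [Finset.abs_prod]
  exact Finset.prod_le_one (fun _ _ => abs_nonneg _) fun i _ => abs_rademacher_le_one (i + 1) t

lemma walshSet_empty (t : ℝ) : walshSet ∅ t = 1 := by simp [walshSet]

lemma ae_rademacher_sq_eq_one : ∀ᵐ t : ℝ, ∀ k, rademacher k t ^ 2 = 1 := by
  rw [ae_all_iff]
  intro k
  have hc : (Set.range fun n : ℤ => (n : ℝ) / 2 ^ k).Countable := Set.countable_range _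
  filter_upwards [hc.ae_notMem volume] with t ht
  have hs : Real.sin (2 ^ k * Real.pi * t) ≠ 0 := by
    intro h
    obtain ⟨n, hn⟩ := Real.sin_eq_zero_iff.1 h
    refine ht ⟨n, ?_⟩
    have : (n : ℝ) = 2 ^ k * t := by
      have := Real.pi_ne_zero
      apply mul_right_cancel₀ this
      linarith
    simp only [this]
    field_simp
  unfold rademacher
  rcases lt_or_gt_of_ne hs with h | h
  · rw [Real.sign_of_neg h]; norm_num
  · rw [Real.sign_of_pos h]; norm_num

lemma walshSet_sq {t : ℝ} (ht : ∀ k, rademacher k t ^ 2 = 1) (I : Finset ℕ) :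
    walshSet I t ^ 2 = 1 := by
  unfold walshSet
  rw [← Finset.prod_pow]
  exact Finset.prod_eq_one fun i _ => ht _

/-- The factors over `I ∩ J` occur twice and square to one. -/
lemma walshSet_mul {t : ℝ} (ht : ∀ k, rademacher k t ^ 2 = 1) (I J : Finset ℕ) :
    walshSet I t * walshSet J t = walshSet (symmDiff I J) t := by
  have hI : walshSet I t = walshSet (I \ J) t * walshSet (I ∩ J) t := by
    unfold walshSet
    rw [mul_comm, Finset.prod_inter_mul_prod_sdiff]
  have hJ : walshSet J t = walshSet (J \ I) t * walshSet (I ∩ J) t := by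
    unfold walshSet
    rw [mul_comm, Finset.inter_comm, Finset.prod_inter_mul_prod_sdiff]
  have hD : walshSet (symmDiff I J) t = walshSet (I \ J) t * walshSet (J \ I) t := by
    unfold walshSet
    rw [symmDiff_def, Finset.sup_eq_union, Finset.prod_union disjoint_sdiff_sdiff]
  rw [hI, hJ, hD]
  linear_combination (walshSet (I \ J) t * walshSet (J \ I) t) * walshSet_sq ht (I ∩ J)

lemma rademacher_add_of_lt {i j : ℕ} (h : i < j) (t : ℝ) :
    rademacher (j + 1) (t + 1 / 2 ^ (i + 1)) = rademacher (j + 1) t := by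
  obtain ⟨d, rfl⟩ := Nat.exists_eq_add_of_lt h
  unfold rademacher
  have : (2 : ℝ) ^ (i + d + 1 + 1) * Real.pi * (t + 1 / 2 ^ (i + 1))
      = 2 ^ (i + d + 1 + 1) * Real.pi * t + ((2 ^ d : ℕ) : ℝ) * (2 * Real.pi) := by
    push_cast
    field_simp
    ring
  rw [this, Real.sin_add_nat_mul_two_pi]

lemma rademacher_add_self (i : ℕ) (t : ℝ) :
    rademacher (i + 1) (t + 1 / 2 ^ (i + 1)) = -rademacher (i + 1) t := by
  unfold rademacher
  have : (2 : ℝ) ^ (i + 1) * Real.pi * (t + 1 / 2 ^ (i + 1))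
      = 2 ^ (i + 1) * Real.pi * t + Real.pi := by
    field_simp
  rw [this, Real.sin_add_pi, Real.sign_neg]

lemma rademacher_periodic (j : ℕ) : Function.Periodic (rademacher (j + 1)) 1 := by
  intro t
  unfold rademacher
  have : (2 : ℝ) ^ (j + 1) * Real.pi * (t + 1)
      = 2 ^ (j + 1) * Real.pi * t + ((2 ^ j : ℕ) : ℝ) * (2 * Real.pi) := by
    push_cast
    ring
  rw [this, Real.sin_add_nat_mul_two_pi]

/-- Translation by half a period of the lowest Rademacher factor flips that factor and fixes all
higher ones, while 1-periodicity preserves the integral; hence the integral equals its negative. -/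
lemma intervalIntegral_walshSet {I : Finset ℕ} (hI : I.Nonempty) :
    ∫ t in (0 : ℝ)..1, walshSet I t = 0 := by
  have hper : Function.Periodic (walshSet I) 1 := fun t =>
    Finset.prod_congr rfl fun i _ => rademacher_periodic i t
  have hanti : ∀ t, walshSet I (t + 1 / 2 ^ (I.min' hI + 1)) = -walshSet I t := by
    intro t
    have hm := I.min'_mem hI
    unfold walshSet
    rw [← Finset.mul_prod_erase I _ hm, ← Finset.mul_prod_erase I (fun i => rademacher (i + 1) t) hm,
      rademacher_add_self, neg_mul]
    congr 2
    exact Finset.prod_congr rfl fun i hi =>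
      rademacher_add_of_lt (I.min'_lt_of_mem_erase_min' hI hi) t
  have h1 : ∫ t in (0 : ℝ)..1, walshSet I (t + 1 / 2 ^ (I.min' hI + 1))
      = ∫ t in (0 : ℝ)..1, walshSet I t := by
    rw [intervalIntegral.integral_comp_add_right]
    have := hper.intervalIntegral_add_eq (0 + 1 / 2 ^ (I.min' hI + 1)) 0
    rw [zero_add (1 : ℝ)] at this
    rw [← this]
    congr 1
    ring
  simp only [hanti, intervalIntegral.integral_neg] at h1
  linarith

instance isProbabilityMeasure_unitMeasure : IsProbabilityMeasure unitMeasure := by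
  constructor
  simp [unitMeasure]

lemma integral_walshSet {I : Finset ℕ} (hI : I.Nonempty) : ∫ t, walshSet I t ∂unitMeasure = 0 := by
  rw [unitMeasure, integral_Icc_eq_integral_Ioc, ← intervalIntegral.integral_of_le zero_le_one,
    intervalIntegral_walshSet hI]

lemma memLp_walshSet (I : Finset ℕ) : MemLp (walshSet I) 2 unitMeasure :=
  MemLp.of_bound (measurable_walshSet I).aestronglyMeasurable 1
    (Filter.Eventually.of_forall fun t => abs_walshSet_le_one I t)

/-- The Walsh function `walshSet I` as an element of `L²([0,1])`. -/
noncomputable def walshSetLp (I : Finset ℕ) : Lp ℝ 2 unitMeasure := (memLp_walshSet I).toLp (walshSet I)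

lemma ae_unitMeasure_rademacher_sq : ∀ᵐ t ∂unitMeasure, ∀ k, rademacher k t ^ 2 = 1 :=
  ae_restrict_of_ae ae_rademacher_sq_eq_one

lemma inner_toLp_eq_integral {μ : Measure ℝ} {f g : ℝ → ℝ} (hf : MemLp f 2 μ) (hg : MemLp g 2 μ) :
    inner ℝ (hf.toLp f) (hg.toLp g) = ∫ t, f t * g t ∂μ := by
  rw [L2.inner_def]
  refine integral_congr_ae ?_
  filter_upwards [hf.coeFn_toLp, hg.coeFn_toLp] with t h1 h2
  simp [h1, h2, mul_comm]

lemma orthonormal_walshSetLp : Orthonormal ℝ walshSetLp := by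
  have key : ∀ I J, inner ℝ (walshSetLp I) (walshSetLp J)
      = ∫ t, walshSet (symmDiff I J) t ∂unitMeasure := by
    intro I J
    rw [walshSetLp, walshSetLp, inner_toLp_eq_integral]
    refine integral_congr_ae ?_
    filter_upwards [ae_unitMeasure_rademacher_sq] with t ht
    exact walshSet_mul ht I J
  rw [orthonormal_iff_ite]
  intro I J
  rw [key]
  split_ifs with h
  · subst h
    simp [walshSet_empty]
  · refine integral_walshSet ?_
    rw [Finset.nonempty_iff_ne_empty, ← Finset.bot_eq_empty, Ne, symmDiff_eq_bot]
    exact h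

/-- The Walsh coefficients of the indicator of `E` at indices with large positions have
arbitrarily small square sum. -/
lemma exists_walsh_tail {E : Set ℝ} (hE : MeasurableSet E) (hE1 : E ⊆ Set.Icc 0 1) {δ : ℝ}
    (hδ : 0 < δ) :
    ∃ L : ℕ, ∀ F : Finset (Finset ℕ), (∀ I ∈ F, ∃ i ∈ I, L ≤ i) →
      ∑ I ∈ F, (∫ t in E, walshSet I t) ^ 2 ≤ δ := by
  have hmem : MemLp (E.indicator fun _ => (1 : ℝ)) 2 unitMeasure :=
    memLp_indicator_const 2 hE 1 (Or.inr (measure_ne_top _ _))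
  have hin : ∀ I, inner ℝ (walshSetLp I) (hmem.toLp _) = ∫ t in E, walshSet I t := by
    intro I
    rw [walshSetLp, inner_toLp_eq_integral]
    have : ∀ t, walshSet I t * E.indicator (fun _ => (1 : ℝ)) t = E.indicator (walshSet I) t := by
      intro t
      by_cases h : t ∈ E <;> simp [h]
    simp only [this]
    rw [integral_indicator hE, unitMeasure, Measure.restrict_restrict hE,
      Set.inter_eq_left.2 hE1]
  have hs : Summable fun I => (∫ t in E, walshSet I t) ^ 2 := by
    have := orthonormal_walshSetLp.inner_products_summable (hmem.toLp _)
    simpa only [hin, Real.norm_eq_abs, sq_abs] using this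
  obtain ⟨s, hs'⟩ := summable_iff_vanishing_norm.1 hs δ hδ
  -- This `L` exceeds every position in the finite exceptional family `s`, so `F` misses `s`.
  refine ⟨s.sup (fun I => I.sup id) + 1, fun F hF => ?_⟩
  have hd : Disjoint F s := by
    rw [Finset.disjoint_left]
    intro I hI hIs
    obtain ⟨i, hi, hL⟩ := hF I hI
    have h1 : i ≤ I.sup id := Finset.le_sup (f := id) hi
    have h2 : I.sup id ≤ s.sup (fun I => I.sup id) := Finset.le_sup (f := fun I => I.sup id) hIs
    omega
  exact (le_abs_self _).trans (hs' F hd).le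

/-! ### Binary digits of lacunary indices. -/

/-- The set of positions of the binary digits `1` of `n`. -/
def bitSet (n : ℕ) : Finset ℕ := n.bitIndices.toFinset

lemma sum_bitSet (n : ℕ) : ∑ i ∈ bitSet n, 2 ^ i = n := Finset.sum_toFinset_bitIndices_two_pow n

lemma bitSet_injective : Function.Injective bitSet := fun m n h => by
  rw [← sum_bitSet m, ← sum_bitSet n, h]

lemma two_pow_le_of_mem_bitSet {n i : ℕ} (h : i ∈ bitSet n) : 2 ^ i ≤ n := by
  conv_rhs => rw [← sum_bitSet n]
  exact Finset.single_le_sum (f := fun i => 2 ^ i) (fun _ _ => Nat.zero_le _) h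

lemma le_log_of_mem_bitSet {n i : ℕ} (h : i ∈ bitSet n) : i ≤ Nat.log 2 n :=
  Nat.le_log_of_pow_le one_lt_two (two_pow_le_of_mem_bitSet h)

lemma log_mem_bitSet {n : ℕ} (hn : n ≠ 0) : Nat.log 2 n ∈ bitSet n := by
  by_contra h
  have h1 : ∑ i ∈ bitSet n, 2 ^ i < 2 ^ Nat.log 2 n := by
    refine Nat.geomSum_lt le_rfl fun i hi => ?_
    rcases (le_log_of_mem_bitSet hi).lt_or_eq with h2 | h2
    · exact h2
    · exact absurd (h2 ▸ hi) h
  rw [sum_bitSet] at h1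
  exact absurd (Nat.pow_log_le_self 2 hn) (not_le.2 h1)

/-- The excess of `n` over `m` is at most the part of `n` on digits absent from `m`, a sum of
distinct powers below `2 ^ d`. -/
lemma lt_add_two_pow_of_symmDiff {m n d : ℕ} (h : ∀ i ∈ symmDiff (bitSet m) (bitSet n), i < d) :
    n < m + 2 ^ d := by
  have h1 : ∑ i ∈ bitSet n \ bitSet m, 2 ^ i < 2 ^ d :=
    Nat.geomSum_lt le_rfl fun i hi => h i (by
      rw [Finset.mem_symmDiff]
      rw [Finset.mem_sdiff] at hi
      exact Or.inr hi)
  have h2 : ∑ i ∈ bitSet n ∩ bitSet m, 2 ^ i ≤ ∑ i ∈ bitSet m, 2 ^ i :=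
    Finset.sum_le_sum_of_subset Finset.inter_subset_right
  have h3 := Finset.sum_inter_add_sum_sdiff (bitSet n) (bitSet m) (fun i => 2 ^ i)
  rw [sum_bitSet] at h2 h3
  omega

namespace IsLacunary

variable {q : ℝ} {n : ℕ → ℕ}

lemma mul_le (h : IsLacunary q n) (k : ℕ) : q * n k ≤ n (k + 1) :=
  (le_div_iff₀ (by exact_mod_cast (h k).1)).1 (h k).2

lemma pow_mul_le (hq : 1 < q) (h : IsLacunary q n) (k m : ℕ) : q ^ m * n k ≤ n (k + m) := by
  induction m with
  | zero => simp
  | succ m ih =>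
    calc q ^ (m + 1) * n k = q * (q ^ m * n k) := by ring
      _ ≤ q * n (k + m) := by gcongr
      _ ≤ n (k + (m + 1)) := h.mul_le (k + m)

lemma strictMono (hq : 1 < q) (h : IsLacunary q n) : StrictMono n := by
  refine strictMono_nat_of_lt_succ fun k => ?_
  have h1 := h.mul_le k
  have h2 : (0 : ℝ) < n k := by exact_mod_cast (h k).1
  have h3 : (n k : ℝ) < n (k + 1) := by nlinarith
  exact_mod_cast h3

lemma mul_le_of_lt (hq : 1 < q) (h : IsLacunary q n) {j k : ℕ} (hjk : j < k) :
    q * n j ≤ n k :=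
  (h.mul_le j).trans (by exact_mod_cast (h.strictMono hq).monotone hjk)

/-- Otherwise the two indices differ by less than `2 ^ L`, while lacunarity gives `n k - n j ≥ (1 -
1/q) n k ≥ 2 ^ L`. -/
lemma exists_le_mem_symmDiff (hq : 1 < q) (h : IsLacunary q n) {L : ℕ}
    (hN : ∀ k, (2 : ℝ) ^ L * q ≤ (q - 1) * n k) {j k : ℕ} (hjk : j < k) :
    ∃ i ∈ symmDiff (bitSet (n j)) (bitSet (n k)), L ≤ i := by
  by_contra! hcon
  have h1 : (n k : ℝ) < n j + 2 ^ L := by exact_mod_cast lt_add_two_pow_of_symmDiff hcon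
  have h2 := h.mul_le_of_lt hq hjk
  have h3 := hN k
  nlinarith

/-- If `k < k'` lie in one class mod `M`, the top position `d` of the common symmetric difference
satisfies `2 ^ d ≤ n k`, so `n k' - n j' < 2 n k`. But `n k' - n j' ≥ (1 - 1/q) q ^ M n k ≥ 2 n k`,
which is what `hM` is designed for. -/
lemma eq_of_symmDiff_eq (hq : 1 < q) (h : IsLacunary q n) {M : ℕ} (hM : 2 * q ≤ (q - 1) * q ^ M)
    {j k j' k' : ℕ} (hjk : j < k) (hjk' : j' < k') (hmod : k % M = k' % M)
    (hD : symmDiff (bitSet (n j)) (bitSet (n k)) = symmDiff (bitSet (n j')) (bitSet (n k'))) :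
    j = j' ∧ k = k' := by
  have hinj := (h.strictMono hq).injective
  have key : ∀ {j k j' k' : ℕ}, j < k → j' < k' → k % M = k' % M →
      symmDiff (bitSet (n j)) (bitSet (n k)) = symmDiff (bitSet (n j')) (bitSet (n k')) →
      ¬ k < k' := by
    intro j k j' k' hjk hjk' hmod hD hlt
    have hne : (symmDiff (bitSet (n j')) (bitSet (n k'))).Nonempty := by
      rw [Finset.nonempty_iff_ne_empty, ← Finset.bot_eq_empty, Ne, symmDiff_eq_bot]
      exact fun h' => hjk'.ne (hinj (bitSet_injective h'))
    obtain ⟨d, hd, hmax⟩ := Finset.exists_max_image _ id hne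
    have h1 : n k' < n j' + 2 ^ (d + 1) :=
      lt_add_two_pow_of_symmDiff fun i hi => Nat.lt_succ_of_le (hmax i hi)
    have h2 : 2 ^ d ≤ n k := by
      rw [← hD, Finset.mem_symmDiff] at hd
      rcases hd with hd | hd
      · exact (two_pow_le_of_mem_bitSet hd.1).trans ((h.strictMono hq).monotone hjk.le)
      · exact two_pow_le_of_mem_bitSet hd.1
    have h3 : k + M ≤ k' := by
      have := (Nat.modEq_iff_dvd' hlt.le).1 hmod
      have := Nat.le_of_dvd (by omega) this
      omega
    have h4 : q ^ M * n k ≤ n k' := (h.pow_mul_le hq k M).trans (by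
      exact_mod_cast (h.strictMono hq).monotone h3)
    have h5 := h.mul_le_of_lt hq hjk'
    have h6 : (n k' : ℝ) < n j' + 2 * n k := by
      have : n k' < n j' + 2 * n k := by rw [pow_succ] at h1; omega
      exact_mod_cast this
    have h7 : (0 : ℝ) ≤ n k := Nat.cast_nonneg _
    have h8 : (q - 1) * (q ^ M * n k) ≤ (q - 1) * n k' :=
      mul_le_mul_of_nonneg_left h4 (by linarith)
    nlinarith [mul_le_mul_of_nonneg_right hM h7]
  have hk : k = k' := le_antisymm (not_lt.1 (key hjk' hjk hmod.symm hD.symm))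
    (not_lt.1 (key hjk hjk' hmod hD))
  subst hk
  exact ⟨hinj (bitSet_injective (symmDiff_left_injective _ hD)), rfl⟩

end IsLacunary

/-! ### The lower `L²(E)` estimate. -/

lemma integrable_of_abs_le {μ : Measure ℝ} [IsFiniteMeasure μ] {f : ℝ → ℝ} (hf : Measurable f)
    {C : ℝ} (hC : ∀ t, |f t| ≤ C) : Integrable f μ :=
  Integrable.of_bound hf.aestronglyMeasurable C (Filter.Eventually.of_forall hC)

lemma integrable_walshSet {μ : Measure ℝ} [IsFiniteMeasure μ] (I : Finset ℕ) :
    Integrable (walshSet I) μ :=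
  integrable_of_abs_le (measurable_walshSet I) (abs_walshSet_le_one I)

lemma sum_range_symmetric {f : ℕ → ℕ → ℝ} (hf : ∀ j k, f j k = f k j) (n : ℕ) :
    ∑ j ∈ Finset.range n, ∑ k ∈ Finset.range n, f j k
      = ∑ k ∈ Finset.range n, f k k
        + 2 * ∑ p ∈ (Finset.range n).sigma Finset.range, f p.2 p.1 := by
  rw [Finset.sum_sigma]
  induction n with
  | zero => simp
  | succ n ih =>
    simp only [Finset.sum_range_succ, Finset.sum_add_distrib] at ih ⊢
    rw [ih, Finset.sum_congr rfl fun k _ => hf n k]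
    ring

/-- Off-diagonal Walsh coefficients along a lacunary sequence are square summable with a small
sum. -/
lemma IsLacunary.sum_offDiag_sq_le {q : ℝ} {n : ℕ → ℕ} (hq : 1 < q) (h : IsLacunary q n) {M L : ℕ}
    (hM0 : 0 < M) (hM : 2 * q ≤ (q - 1) * q ^ M) (hN : ∀ k, (2 : ℝ) ^ L * q ≤ (q - 1) * n k)
    {c : Finset ℕ → ℝ} {δ : ℝ}
    (hc : ∀ F : Finset (Finset ℕ), (∀ I ∈ F, ∃ i ∈ I, L ≤ i) → ∑ I ∈ F, c I ^ 2 ≤ δ) (m : ℕ) :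
    ∑ p ∈ (Finset.range m).sigma Finset.range,
      c (symmDiff (bitSet (n p.2)) (bitSet (n p.1))) ^ 2 ≤ M * δ := by
  classical
  -- Within one residue class of the larger index, pairs are determined by their symmetric
  -- difference, so each class costs at most `δ`.
  rw [← Finset.sum_fiberwise_of_maps_to (t := Finset.range M) (g := fun p => p.1 % M)
    (fun p _ => Finset.mem_range.2 (Nat.mod_lt _ hM0))]
  calc _ ≤ ∑ r ∈ Finset.range M, δ := Finset.sum_le_sum fun r _ => ?_
    _ = M * δ := by simp
  rw [← Finset.sum_image (f := fun I => c I ^ 2)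
    (g := fun p : (_ : ℕ) × ℕ => symmDiff (bitSet (n p.2)) (bitSet (n p.1)))]
  · refine hc _ fun I hI => ?_
    obtain ⟨p, hp, rfl⟩ := Finset.mem_image.1 hI
    rw [Finset.mem_filter, Finset.mem_sigma, Finset.mem_range, Finset.mem_range] at hp
    exact h.exists_le_mem_symmDiff hq hN hp.1.2
  · rintro ⟨k, j⟩ hp ⟨k', j'⟩ hp' heq
    simp only [Finset.coe_filter, Finset.mem_sigma, Finset.mem_range, Set.mem_ofPred_eq] at hp hp'
    obtain ⟨rfl, rfl⟩ :=
      h.eq_of_symmDiff_eq hq hM hp.1.2 hp'.1.2 (hp.2.trans hp'.2.symm) heq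
    rfl

/-- Lower `L²(E)` estimate for finite lacunary Walsh sums. -/
lemma IsLacunary.le_setIntegral_sq {q : ℝ} {n : ℕ → ℕ} (hq : 1 < q) (h : IsLacunary q n) {M L : ℕ}
    (hM0 : 0 < M) (hM : 2 * q ≤ (q - 1) * q ^ M) (hN : ∀ k, (2 : ℝ) ^ L * q ≤ (q - 1) * n k)
    {E : Set ℝ} [IsFiniteMeasure (volume.restrict E)] {δ : ℝ}
    (hc : ∀ F : Finset (Finset ℕ), (∀ I ∈ F, ∃ i ∈ I, L ≤ i) →
      ∑ I ∈ F, (∫ t in E, walshSet I t) ^ 2 ≤ δ)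
    (hδ : 16 * M * δ ≤ volume.real E ^ 2) (a : ℕ → ℝ) (m : ℕ) :
    volume.real E / 2 * ∑ k ∈ Finset.range m, a k ^ 2
      ≤ ∫ t in E, (∑ k ∈ Finset.range m, a k * walsh (n k) t) ^ 2 := by
  set c : Finset ℕ → ℝ := fun I => ∫ t in E, walshSet I t with hcdef
  set D : ℕ → ℕ → Finset ℕ := fun j k => symmDiff (bitSet (n j)) (bitSet (n k)) with hD
  set σ := ∑ k ∈ Finset.range m, a k ^ 2 with hσ
  have hσ0 : 0 ≤ σ := Finset.sum_nonneg fun _ _ => sq_nonneg _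
  have hexp : ∫ t in E, (∑ k ∈ Finset.range m, a k * walsh (n k) t) ^ 2
      = ∑ j ∈ Finset.range m, ∑ k ∈ Finset.range m, a j * a k * c (D j k) := by
    have h1 : ∫ t in E, (∑ k ∈ Finset.range m, a k * walsh (n k) t) ^ 2
        = ∫ t in E, ∑ j ∈ Finset.range m, ∑ k ∈ Finset.range m,
          a j * a k * walshSet (D j k) t := by
      refine integral_congr_ae ?_
      filter_upwards [ae_restrict_of_ae ae_rademacher_sq_eq_one] with t ht
      rw [sq, Finset.sum_mul_sum]
      refine Finset.sum_congr rfl fun j _ => Finset.sum_congr rfl fun k _ => ?_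
      rw [walsh_eq_walshSet, walsh_eq_walshSet, hD]
      simp only [bitSet]
      rw [← walshSet_mul ht]
      ring
    rw [h1, integral_finsetSum _ fun j _ => integrable_finsetSum _ fun k _ =>
      (integrable_walshSet _).const_mul _]
    refine Finset.sum_congr rfl fun j _ => ?_
    rw [integral_finsetSum _ fun k _ => (integrable_walshSet _).const_mul _]
    exact Finset.sum_congr rfl fun k _ => integral_const_mul _ _
  have hdiag : ∀ k, c (D k k) = volume.real E := by
    intro k
    simp [hcdef, hD, walshSet_empty]
  rw [hexp, sum_range_symmetric (fun j k => by rw [hD]; simp only [symmDiff_comm]; ring)]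
  have hd : ∑ k ∈ Finset.range m, a k * a k * c (D k k) = volume.real E * σ := by
    rw [hσ, Finset.mul_sum]
    exact Finset.sum_congr rfl fun k _ => by rw [hdiag]; ring
  rw [hd]
  set T := (Finset.range m).sigma Finset.range
  have hcs := Finset.sum_mul_sq_le_sq_mul_sq T (fun p => a p.2 * a p.1) (fun p => c (D p.2 p.1))
  have hA : ∑ p ∈ T, (a p.2 * a p.1) ^ 2 ≤ σ ^ 2 := by
    have h1 := sum_range_symmetric (f := fun j k => (a j * a k) ^ 2) (fun j k => by ring) m
    have h2 : ∑ j ∈ Finset.range m, ∑ k ∈ Finset.range m, (a j * a k) ^ 2 = σ ^ 2 := by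
      rw [sq σ, hσ, Finset.sum_mul_sum]
      simp only [mul_pow]
    have h3 : 0 ≤ ∑ k ∈ Finset.range m, (a k * a k) ^ 2 := Finset.sum_nonneg fun _ _ => sq_nonneg _
    have h4 : 0 ≤ ∑ p ∈ T, (a p.2 * a p.1) ^ 2 := Finset.sum_nonneg fun _ _ => sq_nonneg _
    linarith
  have hB : ∑ p ∈ T, c (D p.2 p.1) ^ 2 ≤ M * δ := h.sum_offDiag_sq_le hq hM0 hM hN hc m
  have hB0 : 0 ≤ ∑ p ∈ T, c (D p.2 p.1) ^ 2 := Finset.sum_nonneg fun _ _ => sq_nonneg _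
  set X := ∑ p ∈ T, a p.2 * a p.1 * c (D p.2 p.1) with hX
  -- The constant 16 in `hδ` makes `|X|` at most a quarter of the diagonal; `X` counts twice, so
  -- half of the diagonal survives.
  have hX2 : X ^ 2 ≤ (volume.real E / 4 * σ) ^ 2 :=
    calc X ^ 2 ≤ σ ^ 2 * (M * δ) := hcs.trans (mul_le_mul hA hB hB0 (sq_nonneg _))
      _ ≤ σ ^ 2 * (volume.real E ^ 2 / 16) := by
        refine mul_le_mul_of_nonneg_left ?_ (sq_nonneg _)
        linarith
      _ = _ := by ring
  have := abs_le_of_sq_le_sq hX2 (by positivity)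
  linarith [(abs_le.1 this).1]

/-! ### Riesz products and exponential moments on `E`. -/

/-- Walsh expansion of a Riesz product over index sets with strictly increasing top positions. -/
lemma exists_walsh_expansion_prod {J : ℕ → Finset ℕ} {τ : ℕ → ℕ} (hτ : StrictMono τ)
    (hmem : ∀ k, τ k ∈ J k) (hle : ∀ k, ∀ i ∈ J k, i ≤ τ k) (α β : ℕ → ℝ) (n : ℕ) :
    ∃ (G : Finset (Finset ℕ)) (b : Finset ℕ → ℝ), ∅ ∈ G ∧ b ∅ = ∏ k ∈ Finset.range n, α k ∧
      (∀ I ∈ G, ∀ i ∈ I, i < τ n) ∧ (∀ I ∈ G, I ≠ ∅ → ∃ i ∈ I, τ 0 ≤ i) ∧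
      ∑ I ∈ G, b I ^ 2 = ∏ k ∈ Finset.range n, (α k ^ 2 + β k ^ 2) ∧
      ∀ t, (∀ k, rademacher k t ^ 2 = 1) →
        ∏ k ∈ Finset.range n, (α k + β k * walshSet (J k) t) = ∑ I ∈ G, b I * walshSet I t := by
  induction n with
  | zero =>
    refine ⟨{∅}, fun _ => 1, by simp, by simp, by simp, by simp, by simp, fun t _ => ?_⟩
    simp [walshSet_empty]
  | succ n ih =>
    obtain ⟨G, b, h0, hb0, hlt, hbig, hsq, hW⟩ := ih
    have hnot : ∀ I ∈ G, τ n ∉ I := fun I hI h => (hlt I hI _ h).false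
    have hin : ∀ I ∈ G, τ n ∈ symmDiff I (J n) := fun I hI =>
      Finset.mem_symmDiff.2 (Or.inr ⟨hmem n, hnot I hI⟩)
    set e : Finset ℕ → Finset ℕ := fun I => symmDiff I (J n) with he
    have hinv : ∀ I, symmDiff (e I) (J n) = I := fun I => symmDiff_symmDiff_cancel_right _ _
    -- Position `τ n` is new: it tells the terms that used the `n`-th factor from those that did
    -- not, so no two terms merge and the squares of the coefficients multiply.
    set b' : Finset ℕ → ℝ := fun I =>
      if τ n ∈ I then β n * b (symmDiff I (J n)) else α n * b I with hb'
    have hdisj : Disjoint G (G.image e) := by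
      rw [Finset.disjoint_left]
      intro I hI hI'
      obtain ⟨K, hK, rfl⟩ := Finset.mem_image.1 hI'
      exact hnot _ hI (hin K hK)
    have hbG : ∀ I ∈ G, b' I = α n * b I := fun I hI => if_neg (hnot I hI)
    have hbe : ∀ I ∈ G, b' (e I) = β n * b I := fun I hI => by
      simp only [hb']
      rw [if_pos (hin I hI), hinv]
    have hsum : ∀ g : Finset ℕ → ℝ, ∑ I ∈ G ∪ G.image e, g I = ∑ I ∈ G, (g I + g (e I)) := by
      intro g
      rw [Finset.sum_union hdisj, Finset.sum_image (symmDiff_left_injective (J n)).injOn,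
        Finset.sum_add_distrib]
    refine ⟨G ∪ G.image e, b', Finset.mem_union_left _ h0, ?_, ?_, ?_, ?_, ?_⟩
    · rw [hbG _ h0, hb0, Finset.prod_range_succ, mul_comm]
    · intro I hI i hi
      have hn : τ n < τ (n + 1) := hτ n.lt_succ_self
      rcases Finset.mem_union.1 hI with hI | hI
      · exact (hlt I hI i hi).trans hn
      · obtain ⟨K, hK, rfl⟩ := Finset.mem_image.1 hI
        rcases Finset.mem_symmDiff.1 hi with h | h
        · exact (hlt K hK i h.1).trans hn
        · exact (hle n i h.1).trans_lt hn
    · intro I hI hne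
      rcases Finset.mem_union.1 hI with hI | hI
      · exact hbig I hI hne
      · obtain ⟨K, hK, rfl⟩ := Finset.mem_image.1 hI
        exact ⟨τ n, hin K hK, hτ.monotone n.zero_le⟩
    · rw [hsum, Finset.prod_range_succ, ← hsq, Finset.sum_mul]
      refine Finset.sum_congr rfl fun I hI => ?_
      rw [hbG I hI, hbe I hI]
      ring
    · intro t ht
      rw [hsum, Finset.prod_range_succ, hW t ht, Finset.sum_mul]
      refine Finset.sum_congr rfl fun I hI => ?_
      rw [hbG I hI, hbe I hI, ← walshSet_mul ht]
      ring

/-- The empty index set yields the main term. Every other Walsh term has a position at least `τ 0 ≥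
L`, so Cauchy–Schwarz against the coefficient tail yields the square root. -/
lemma setIntegral_prod_le {J : ℕ → Finset ℕ} {τ : ℕ → ℕ} (hτ : StrictMono τ)
    (hmem : ∀ k, τ k ∈ J k) (hle : ∀ k, ∀ i ∈ J k, i ≤ τ k) {L : ℕ} (hL : L ≤ τ 0)
    {E : Set ℝ} [IsFiniteMeasure (volume.restrict E)] {δ : ℝ}
    (hc : ∀ F : Finset (Finset ℕ), (∀ I ∈ F, ∃ i ∈ I, L ≤ i) →
      ∑ I ∈ F, (∫ t in E, walshSet I t) ^ 2 ≤ δ) (α β : ℕ → ℝ) (n : ℕ) :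
    ∫ t in E, ∏ k ∈ Finset.range n, (α k + β k * walshSet (J k) t)
      ≤ volume.real E * ∏ k ∈ Finset.range n, α k
        + √(δ * ∏ k ∈ Finset.range n, (α k ^ 2 + β k ^ 2)) := by
  obtain ⟨G, b, h0, hb0, -, hbig, hsq, hW⟩ := exists_walsh_expansion_prod hτ hmem hle α β n
  have h1 : ∫ t in E, ∏ k ∈ Finset.range n, (α k + β k * walshSet (J k) t)
      = ∑ I ∈ G, b I * ∫ t in E, walshSet I t := by
    have : ∫ t in E, ∏ k ∈ Finset.range n, (α k + β k * walshSet (J k) t)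
        = ∫ t in E, ∑ I ∈ G, b I * walshSet I t := by
      refine integral_congr_ae ?_
      filter_upwards [ae_restrict_of_ae ae_rademacher_sq_eq_one] with t ht using hW t ht
    rw [this, integral_finsetSum _ fun I _ => (integrable_walshSet _).const_mul _]
    exact Finset.sum_congr rfl fun I _ => integral_const_mul _ _
  rw [h1, ← Finset.add_sum_erase G _ h0, hb0]
  have h2 : ∫ t in E, walshSet ∅ t = volume.real E := by simp [walshSet_empty]
  rw [h2, mul_comm]
  gcongr
  refine Real.le_sqrt_of_sq_le ?_
  refine (Finset.sum_mul_sq_le_sq_mul_sq _ _ _).trans ?_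
  rw [← hsq, mul_comm]
  refine mul_le_mul (hc _ fun I hI => ?_) ?_ (Finset.sum_nonneg fun _ _ => sq_nonneg _) ?_
  · rw [Finset.mem_erase] at hI
    exact (hbig I hI.2 hI.1).imp fun i hi => ⟨hi.1, hL.trans hi.2⟩
  · exact Finset.sum_le_sum_of_subset_of_nonneg (Finset.erase_subset _ _)
      fun _ _ _ => sq_nonneg _
  -- The empty family gives `0 ≤ δ`.
  · simpa using hc ∅ (by simp)

lemma exp_mul_of_sq_eq_one {x w : ℝ} (hw : w ^ 2 = 1) :
    Real.exp (x * w) = Real.cosh x + Real.sinh x * w := by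
  rw [sq, mul_self_eq_one_iff] at hw
  rcases hw with rfl | rfl
  · simp [Real.cosh_add_sinh]
  · simp [← Real.cosh_sub_sinh, sub_eq_add_neg]

/-- With `α = cosh a` and `β = sinh a`, one has `α ^ 2 + β ^ 2 = cosh (2a) ≤ exp (2a²)`; the main
term and the square root are each bounded by `m(E) exp (∑ a_k²)`, whence the factor 2. -/
lemma setIntegral_exp_walshSet_le {J : ℕ → Finset ℕ} {τ : ℕ → ℕ} (hτ : StrictMono τ)
    (hmem : ∀ k, τ k ∈ J k) (hle : ∀ k, ∀ i ∈ J k, i ≤ τ k) {L : ℕ} (hL : L ≤ τ 0)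
    {E : Set ℝ} [IsFiniteMeasure (volume.restrict E)] {δ : ℝ}
    (hc : ∀ F : Finset (Finset ℕ), (∀ I ∈ F, ∃ i ∈ I, L ≤ i) →
      ∑ I ∈ F, (∫ t in E, walshSet I t) ^ 2 ≤ δ)
    (hδ : δ ≤ volume.real E ^ 2) (a : ℕ → ℝ) (n : ℕ) :
    ∫ t in E, Real.exp (∑ k ∈ Finset.range n, a k * walshSet (J k) t)
      ≤ 2 * volume.real E * Real.exp (∑ k ∈ Finset.range n, a k ^ 2) := by
  have hσ0 : 0 ≤ ∑ k ∈ Finset.range n, a k ^ 2 := Finset.sum_nonneg fun _ _ => sq_nonneg _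
  have h1 : ∫ t in E, Real.exp (∑ k ∈ Finset.range n, a k * walshSet (J k) t)
      = ∫ t in E, ∏ k ∈ Finset.range n,
        (Real.cosh (a k) + Real.sinh (a k) * walshSet (J k) t) := by
    refine integral_congr_ae ?_
    filter_upwards [ae_restrict_of_ae ae_rademacher_sq_eq_one] with t ht
    rw [Real.exp_sum]
    exact Finset.prod_congr rfl fun k _ => exp_mul_of_sq_eq_one (walshSet_sq ht _)
  rw [h1]
  refine (setIntegral_prod_le hτ hmem hle hL hc _ _ n).trans ?_
  have h2 : ∏ k ∈ Finset.range n, Real.cosh (a k) ≤ Real.exp (∑ k ∈ Finset.range n, a k ^ 2) := by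
    rw [Real.exp_sum]
    refine Finset.prod_le_prod (fun k _ => (Real.cosh_pos _).le) fun k _ => ?_
    refine (Real.cosh_le_exp_half_sq _).trans (Real.exp_le_exp.2 ?_)
    linarith [sq_nonneg (a k)]
  have h3 : ∏ k ∈ Finset.range n, (Real.cosh (a k) ^ 2 + Real.sinh (a k) ^ 2)
      ≤ Real.exp (∑ k ∈ Finset.range n, a k ^ 2) ^ 2 := by
    rw [Real.exp_sum, ← Finset.prod_pow]
    refine Finset.prod_le_prod (fun k _ => by positivity) fun k _ => ?_
    rw [← Real.cosh_two_mul, ← Real.exp_nat_mul]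
    refine (Real.cosh_le_exp_half_sq _).trans (Real.exp_le_exp.2 ?_)
    push_cast
    linarith
  have h4 : √(δ * ∏ k ∈ Finset.range n, (Real.cosh (a k) ^ 2 + Real.sinh (a k) ^ 2))
      ≤ volume.real E * Real.exp (∑ k ∈ Finset.range n, a k ^ 2) := by
    refine Real.sqrt_le_iff.2 ⟨by positivity, ?_⟩
    rw [mul_pow]
    exact mul_le_mul hδ h3 (by positivity) (by positivity)
  have h5 := mul_le_mul_of_nonneg_left h2 (measureReal_nonneg (μ := volume) (s := E))
  linarith

lemma sum_range_mul {M : ℕ} (f : ℕ → ℝ) (m : ℕ) :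
    ∑ k ∈ Finset.range (M * m), f k
      = ∑ r ∈ Finset.range M, ∑ k ∈ Finset.range m, f (r + M * k) := by
  induction m with
  | zero => simp
  | succ m ih =>
    simp only [Finset.sum_range_succ, Finset.sum_add_distrib, Nat.mul_succ, Finset.sum_range_add, ih]
    congr 1
    exact Finset.sum_congr rfl fun r _ => by rw [add_comm]

/-- Exponential moments over `E` of finite lacunary Walsh sums. -/
lemma IsLacunary.setIntegral_exp_le {q : ℝ} {n : ℕ → ℕ} (hq : 1 < q) (h : IsLacunary q n)
    {M L : ℕ} (hM0 : 0 < M) (hM : 2 ≤ q ^ M) (hN : ∀ k, 2 ^ L ≤ n k)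
    {E : Set ℝ} [IsFiniteMeasure (volume.restrict E)] {δ : ℝ}
    (hc : ∀ F : Finset (Finset ℕ), (∀ I ∈ F, ∃ i ∈ I, L ≤ i) →
      ∑ I ∈ F, (∫ t in E, walshSet I t) ^ 2 ≤ δ)
    (hδ : δ ≤ volume.real E ^ 2) (a : ℕ → ℝ) {s : ℝ}
    (ha : ∀ m, ∑ k ∈ Finset.range m, a k ^ 2 ≤ s) (m : ℕ) :
    ∫ t in E, Real.exp (∑ k ∈ Finset.range (M * m), a k * walsh (n k) t)
      ≤ 2 * volume.real E * Real.exp (M ^ 2 * s) := by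
  have hMR : (0 : ℝ) < M := by exact_mod_cast hM0
  -- Scaling by `M` makes the full sum the average of the `S r`, ready for Jensen.
  set S : ℕ → ℝ → ℝ := fun r t =>
    ∑ k ∈ Finset.range m, (M * a (r + M * k)) * walshSet (bitSet (n (r + M * k))) t with hS
  have hclass : ∀ r ∈ Finset.range M, ∫ t in E, Real.exp (S r t)
      ≤ 2 * volume.real E * Real.exp (M ^ 2 * s) := by
    intro r hr
    -- Since `q ^ M ≥ 2`, indices at least double along a residue class, so the top binary position
    -- rises.
    have hτ : StrictMono fun k => Nat.log 2 (n (r + M * k)) := by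
      refine strictMono_nat_of_lt_succ fun k => ?_
      have h1 := h.pow_mul_le hq (r + M * k) M
      have h2 : 2 * n (r + M * k) ≤ n (r + M * k + M) := by
        have h3 : (0 : ℝ) ≤ n (r + M * k) := Nat.cast_nonneg _
        have h4 : 2 * (n (r + M * k) : ℝ) ≤ n (r + M * k + M) :=
          (mul_le_mul_of_nonneg_right hM h3).trans h1
        exact_mod_cast h4
      rw [Nat.mul_succ, ← add_assoc]
      have h5 := Nat.log_mono_right (b := 2) h2
      rw [mul_comm, Nat.log_mul_base one_lt_two (h _).1.ne'] at h5
      exact h5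
    refine (setIntegral_exp_walshSet_le (J := fun k => bitSet (n (r + M * k))) hτ
      (fun k => log_mem_bitSet (h _).1.ne') (fun k i hi => le_log_of_mem_bitSet hi)
      (Nat.le_log_of_pow_le one_lt_two (hN _)) hc hδ _ m).trans ?_
    have h6 : ∑ k ∈ Finset.range m, (M * a (r + M * k)) ^ 2 ≤ M ^ 2 * s := by
      simp only [mul_pow]
      rw [← Finset.mul_sum]
      refine mul_le_mul_of_nonneg_left ?_ (by positivity)
      refine le_trans ?_ (ha (M * m))
      rw [sum_range_mul]
      exact Finset.single_le_sum
        (f := fun r => ∑ k ∈ Finset.range m, a (r + M * k) ^ 2)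
        (fun _ _ => Finset.sum_nonneg fun _ _ => sq_nonneg _) hr
    gcongr
  have hmeas : ∀ r, Measurable (S r) := fun r => Finset.measurable_fun_sum _ fun k _ =>
    (measurable_walshSet _).const_mul _
  have hbd : ∀ r t, |S r t| ≤ ∑ k ∈ Finset.range m, |M * a (r + M * k)| := by
    intro r t
    refine (Finset.abs_sum_le_sum_abs _ _).trans (Finset.sum_le_sum fun k _ => ?_)
    rw [abs_mul]
    exact mul_le_of_le_one_right (abs_nonneg _) (abs_walshSet_le_one _ _)
  have hint : ∀ r, Integrable (fun t => Real.exp (S r t)) (volume.restrict E) := fun r =>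
    integrable_of_abs_le (hmeas r).exp (C := Real.exp (∑ k ∈ Finset.range m, |M * a (r + M * k)|))
      fun t => by
        rw [Real.abs_exp]
        exact Real.exp_le_exp.2 ((le_abs_self _).trans (hbd r t))
  have hle : ∀ t, Real.exp (∑ k ∈ Finset.range (M * m), a k * walsh (n k) t)
      ≤ ∑ r ∈ Finset.range M, (M : ℝ)⁻¹ * Real.exp (S r t) := by
    intro t
    have h1 : ∑ k ∈ Finset.range (M * m), a k * walsh (n k) t
        = ∑ r ∈ Finset.range M, (M : ℝ)⁻¹ • S r t := by
      rw [sum_range_mul]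
      refine Finset.sum_congr rfl fun r _ => ?_
      rw [hS, smul_eq_mul, Finset.mul_sum]
      refine Finset.sum_congr rfl fun k _ => ?_
      rw [walsh_eq_walshSet, bitSet]
      field_simp
    rw [h1]
    refine (convexOn_exp.map_sum_le (t := Finset.range M) (fun _ _ => by positivity) ?_
      (fun _ _ => Set.mem_univ _)).trans_eq (by simp)
    simp [hMR.ne']
  calc ∫ t in E, Real.exp (∑ k ∈ Finset.range (M * m), a k * walsh (n k) t)
      ≤ ∫ t in E, ∑ r ∈ Finset.range M, (M : ℝ)⁻¹ * Real.exp (S r t) := by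
        refine integral_mono_of_nonneg (Filter.Eventually.of_forall fun t => (Real.exp_pos _).le)
          (integrable_finsetSum _ fun r _ => (hint r).const_mul _) (Filter.Eventually.of_forall hle)
    _ = ∑ r ∈ Finset.range M, (M : ℝ)⁻¹ * ∫ t in E, Real.exp (S r t) := by
        rw [integral_finsetSum _ fun r _ => (hint r).const_mul _]
        exact Finset.sum_congr rfl fun r _ => integral_const_mul _ _
    _ ≤ ∑ r ∈ Finset.range M, (M : ℝ)⁻¹ * (2 * volume.real E * Real.exp (M ^ 2 * s)) :=
        Finset.sum_le_sum fun r hr => mul_le_mul_of_nonneg_left (hclass r hr) (by positivity)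
    _ = _ := by
        rw [Finset.sum_const, Finset.card_range, nsmul_eq_mul, mul_inv_cancel_left₀ hMR.ne']

/-! ### Transport between `[0,1]` and `E`, and tests for the Luxemburg norm. -/

section Quantile

variable {E : Set ℝ}

lemma measureReal_inter_Icc_le (hE : E ⊆ Set.Icc 0 1) (x : ℝ) :
    volume.real (E ∩ Set.Icc 0 x) ≤ volume.real E :=
  measureReal_mono Set.inter_subset_left
    ((measure_mono hE).trans_lt measure_Icc_lt_top).ne

lemma monotone_rhoE : Monotone (rhoE E) := fun _ _ h =>
  div_le_div_of_nonneg_right (measureReal_mono (Set.inter_subset_inter_right _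
    (Set.Icc_subset_Icc_right h))
    ((measure_mono Set.inter_subset_right).trans_lt measure_Icc_lt_top).ne) measureReal_nonneg

lemma rhoE_le_one (hE : E ⊆ Set.Icc 0 1) (x : ℝ) : rhoE E x ≤ 1 :=
  div_le_one_of_le₀ (measureReal_inter_Icc_le hE x) measureReal_nonneg

lemma rhoE_one (hE : E ⊆ Set.Icc 0 1) (h0 : 0 < volume.real E) : rhoE E 1 = 1 := by
  rw [rhoE, Set.inter_eq_left.2 hE, div_self h0.ne']

lemma continuous_rhoE : Continuous (rhoE E) := by
  have h : LipschitzWith 1 fun x => volume.real (E ∩ Set.Icc 0 x) := by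
    refine LipschitzWith.of_le_add_mul 1 fun x y => ?_
    rw [NNReal.coe_one, one_mul]
    calc volume.real (E ∩ Set.Icc 0 x)
        ≤ volume.real ((E ∩ Set.Icc 0 y) ∪ Set.Icc y x) := by
          refine measureReal_mono ?_ (measure_union_lt_top
            ((measure_mono Set.inter_subset_right).trans_lt measure_Icc_lt_top)
            measure_Icc_lt_top).ne
          rintro z ⟨hz, hz0, hzx⟩
          rcases le_total z y with h | h
          · exact Or.inl ⟨hz, hz0, h⟩
          · exact Or.inr ⟨h, hzx⟩
      _ ≤ volume.real (E ∩ Set.Icc 0 y) + volume.real (Set.Icc y x) := measureReal_union_le _ _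
      _ ≤ volume.real (E ∩ Set.Icc 0 y) + dist x y := by
          rw [Real.volume_real_Icc, Real.dist_eq]
          gcongr
          exact max_le (le_abs_self _) (abs_nonneg _)
  exact h.continuous.div_const _

lemma rhoEInv_mem (hE : E ⊆ Set.Icc 0 1) (h0 : 0 < volume.real E) {t : ℝ} (ht : t ≤ 1) :
    rhoEInv E t ∈ Set.Icc (0 : ℝ) 1 ∧ t ≤ rhoE E (rhoEInv E t) := by
  have hcl : IsClosed {x | x ∈ Set.Icc (0 : ℝ) 1 ∧ t ≤ rhoE E x} :=
    isClosed_Icc.inter (isClosed_le continuous_const continuous_rhoE)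
  exact hcl.csInf_mem ⟨1, by simp, by rwa [rhoE_one hE h0]⟩ ⟨0, fun x hx => hx.1.1⟩

lemma rhoEInv_le_iff (hE : E ⊆ Set.Icc 0 1) (h0 : 0 < volume.real E) {t x : ℝ} (ht : t ≤ 1)
    (hx : 0 ≤ x) : rhoEInv E t ≤ x ↔ t ≤ rhoE E x := by
  obtain ⟨h1, h2⟩ := rhoEInv_mem hE h0 ht
  refine ⟨fun h => h2.trans (monotone_rhoE h), fun h => ?_⟩
  rcases le_total x 1 with hx1 | hx1
  · exact csInf_le ⟨0, fun x hx => hx.1.1⟩ ⟨⟨hx, hx1⟩, h⟩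
  · exact h1.2.trans hx1

/-- Here the infimum is over the empty set and takes its default value 0; this adds `Set.Ioi 1` to
the preimages below, which `unitMeasure` does not see. -/
lemma rhoEInv_of_one_lt (hE : E ⊆ Set.Icc 0 1) {t : ℝ} (ht : 1 < t) : rhoEInv E t = 0 := by
  have : {x | x ∈ Set.Icc (0 : ℝ) 1 ∧ t ≤ rhoE E x} = ∅ := by
    ext x
    simp only [Set.mem_ofPred_eq, Set.mem_empty_iff_false, iff_false, not_and, not_le]
    exact fun _ => (rhoE_le_one hE x).trans_lt ht
  rw [rhoEInv, this, Real.sInf_empty]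

lemma rhoEInv_preimage_Iic (hE : E ⊆ Set.Icc 0 1) (h0 : 0 < volume.real E) {x : ℝ} (hx : 0 ≤ x) :
    rhoEInv E ⁻¹' Set.Iic x = Set.Iic (rhoE E x) ∪ Set.Ioi 1 := by
  ext t
  simp only [Set.mem_preimage, Set.mem_Iic, Set.mem_union, Set.mem_Ioi]
  rcases le_or_gt t 1 with ht | ht
  · simp [rhoEInv_le_iff hE h0 ht hx, ht.not_gt]
  · simp [rhoEInv_of_one_lt hE ht, hx, ht]

lemma rhoEInv_preimage_Iic_of_neg {x : ℝ} (hx : x < 0) : rhoEInv E ⁻¹' Set.Iic x = ∅ := by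
  ext t
  simp only [Set.mem_preimage, Set.mem_Iic, Set.mem_empty_iff_false, iff_false, not_le]
  exact hx.trans_le (Real.sInf_nonneg fun y hy => hy.1.1)

lemma measurable_rhoEInv (hE : E ⊆ Set.Icc 0 1) (h0 : 0 < volume.real E) :
    Measurable (rhoEInv E) := by
  refine measurable_of_Iic fun x => ?_
  rcases le_or_gt 0 x with hx | hx
  · rw [rhoEInv_preimage_Iic hE h0 hx]
    exact measurableSet_Iic.union measurableSet_Ioi
  · rw [rhoEInv_preimage_Iic_of_neg hx]
    exact MeasurableSet.empty

/-- The inverse `ρ_E⁻¹` transports Lebesgue measure on `[0,1]` to normalized Lebesgue measure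
on `E`. -/
lemma map_rhoEInv (hE : E ⊆ Set.Icc 0 1) (h0 : 0 < volume.real E) :
    Measure.map (rhoEInv E) unitMeasure = (volume E)⁻¹ • volume.restrict E := by
  have hm := measurable_rhoEInv hE h0
  have hfin : volume E ≠ ∞ := ((measure_mono hE).trans_lt measure_Icc_lt_top).ne
  refine Measure.ext_of_Iic _ _ fun x => ?_
  rw [Measure.map_apply hm measurableSet_Iic, Measure.smul_apply,
    Measure.restrict_apply measurableSet_Iic]
  rcases le_or_gt 0 x with hx | hx
  · rw [rhoEInv_preimage_Iic hE h0 hx, unitMeasure,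
      Measure.restrict_apply (measurableSet_Iic.union measurableSet_Ioi)]
    have h1 : (Set.Iic (rhoE E x) ∪ Set.Ioi 1) ∩ Set.Icc 0 1 = Set.Icc 0 (rhoE E x) := by
      ext t
      simp only [Set.mem_inter_iff, Set.mem_union, Set.mem_Iic, Set.mem_Ioi, Set.mem_Icc]
      constructor
      · rintro ⟨h | h, h2, h3⟩
        · exact ⟨h2, h⟩
        · exact absurd h h3.not_gt
      · rintro ⟨h2, h⟩
        exact ⟨Or.inl h, h2, h.trans (rhoE_le_one hE x)⟩
    have h2 : Set.Iic x ∩ E = E ∩ Set.Icc 0 x := by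
      ext t
      simp only [Set.mem_inter_iff, Set.mem_Iic, Set.mem_Icc]
      exact ⟨fun h => ⟨h.2, (hE h.2).1, h.1⟩, fun h => ⟨h.2.2, h.1⟩⟩
    have h3 : volume (E ∩ Set.Icc 0 x) ≠ ∞ :=
      ((measure_mono Set.inter_subset_left).trans_lt hfin.lt_top).ne
    rw [h1, h2, Real.volume_Icc, sub_zero, rhoE, ENNReal.ofReal_div_of_pos h0, Measure.real,
      Measure.real, ENNReal.ofReal_toReal h3, ENNReal.ofReal_toReal hfin, smul_eq_mul,
      ENNReal.div_eq_inv_mul]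
  · have h2 : Set.Iic x ∩ E = ∅ := by
      ext t
      simp only [Set.mem_inter_iff, Set.mem_Iic, Set.mem_empty_iff_false, iff_false, not_and]
      exact fun h h' => absurd (hE h').1 (h.trans_lt hx).not_ge
    rw [rhoEInv_preimage_Iic_of_neg hx, h2]
    simp

lemma lintegral_comp_rhoEInv (hE : E ⊆ Set.Icc 0 1) (h0 : 0 < volume.real E) {g : ℝ → ℝ≥0∞}
    (hg : Measurable g) :
    ∫⁻ t, g (rhoEInv E t) ∂unitMeasure = (volume E)⁻¹ * ∫⁻ t in E, g t := by
  rw [← lintegral_map hg (measurable_rhoEInv hE h0), map_rhoEInv hE h0, lintegral_smul_measure,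
    smul_eq_mul]

lemma lintegral_comp_rhoEInv_le_one_iff (hE : E ⊆ Set.Icc 0 1) (h0 : 0 < volume.real E)
    {g : ℝ → ℝ≥0∞} (hg : Measurable g) :
    ∫⁻ t, g (rhoEInv E t) ∂unitMeasure ≤ 1 ↔ ∫⁻ t in E, g t ≤ volume E := by
  have hfin : volume E ≠ ∞ := ((measure_mono hE).trans_lt measure_Icc_lt_top).ne
  have hne : volume E ≠ 0 := fun h => h0.ne' (by simp [Measure.real, h])
  rw [lintegral_comp_rhoEInv hE h0 hg, ← ENNReal.div_eq_inv_mul,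
    ENNReal.div_le_iff hne hfin, one_mul]

lemma measurable_youngM2 : Measurable youngM2 := by
  unfold youngM2
  fun_prop

lemma measurable_ofReal_youngM2 {f : ℝ → ℝ} (hf : Measurable f) (c : ℝ) :
    Measurable fun t => ENNReal.ofReal (youngM2 (|f t| / c)) :=
  (measurable_youngM2.comp ((measurable_norm.comp hf).div_const c)).ennreal_ofReal

lemma localNorm_youngM2_le (hE : E ⊆ Set.Icc 0 1) (h0 : 0 < volume.real E) {f : ℝ → ℝ}
    (hf : Measurable f) {c : ℝ} (hc : 0 < c)
    (h : ∫⁻ t in E, ENNReal.ofReal (youngM2 (|f t| / c)) ≤ volume E) :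
    localNorm (orliczNorm youngM2) E f ≤ ENNReal.ofReal c :=
  iInf₂_le c ⟨hc,
    (lintegral_comp_rhoEInv_le_one_iff hE h0 (measurable_ofReal_youngM2 hf c)).2 h⟩

/-- By `u ≤ exp u - 1`, every admissible `c` satisfies `∫_E f² ≤ c² m(E)`. -/
lemma le_localNorm_youngM2 (hE : E ⊆ Set.Icc 0 1) (h0 : 0 < volume.real E) {f : ℝ → ℝ}
    (hf : Measurable f) {s : ℝ}
    (h : ENNReal.ofReal (s ^ 2) * volume E ≤ ∫⁻ t in E, ENNReal.ofReal (f t ^ 2)) :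
    ENNReal.ofReal s ≤ localNorm (orliczNorm youngM2) E f := by
  have hfin : volume E ≠ ∞ := ((measure_mono hE).trans_lt measure_Icc_lt_top).ne
  have hne : volume E ≠ 0 := fun h => h0.ne' (by simp [Measure.real, h])
  refine le_iInf₂ fun c hc => ENNReal.ofReal_le_ofReal ?_
  obtain ⟨hc, hle⟩ := hc
  have h1 := (lintegral_comp_rhoEInv_le_one_iff hE h0 (measurable_ofReal_youngM2 hf c)).1 hle
  have h2 : ∫⁻ t in E, ENNReal.ofReal (f t ^ 2)
      ≤ ENNReal.ofReal (c ^ 2) * ∫⁻ t in E, ENNReal.ofReal (youngM2 (|f t| / c)) := by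
    rw [← lintegral_const_mul _ (measurable_ofReal_youngM2 hf c)]
    refine lintegral_mono fun t => ?_
    rw [← ENNReal.ofReal_mul (sq_nonneg c)]
    refine ENNReal.ofReal_le_ofReal ?_
    have h3 : (|f t| / c) ^ 2 ≤ youngM2 (|f t| / c) := by
      unfold youngM2
      linarith [Real.add_one_le_exp ((|f t| / c) ^ 2)]
    calc f t ^ 2 = c ^ 2 * (|f t| / c) ^ 2 := by
          rw [div_pow, sq_abs]
          field_simp
      _ ≤ _ := by gcongr
  have h4 : ENNReal.ofReal (s ^ 2) * volume E ≤ ENNReal.ofReal (c ^ 2) * volume E :=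
    h.trans (h2.trans (by gcongr))
  rw [ENNReal.mul_le_mul_iff_left hne hfin, ENNReal.ofReal_le_ofReal_iff (sq_nonneg c)] at h4
  exact le_of_sq_le_sq h4 hc.le

end Quantile

/-! ### From subgaussian exponential moments to an exponential square moment. -/

section Gaussian

open ProbabilityTheory

lemma lintegral_exp_mul_gaussianReal (x : ℝ) :
    ∫⁻ y, ENNReal.ofReal (Real.exp (x * y)) ∂gaussianReal 0 1
      = ENNReal.ofReal (Real.exp (x ^ 2 / 2)) := by
  rw [← ofReal_integral_eq_lintegral_ofReal (integrable_exp_mul_gaussianReal x)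
    (Filter.Eventually.of_forall fun y => (Real.exp_pos _).le)]
  have := congrFun (mgf_id_gaussianReal (μ := 0) (v := 1)) x
  rw [mgf] at this
  simp only [id] at this
  rw [this]
  simp

/-- The integral equals `√2`. -/
lemma lintegral_exp_sq_gaussianReal_le :
    ∫⁻ y, ENNReal.ofReal (Real.exp (y ^ 2 / 4)) ∂gaussianReal 0 1 ≤ 2 := by
  rw [gaussianReal_of_var_ne_zero 0 one_ne_zero, lintegral_withDensity_eq_lintegral_mul _
    (measurable_gaussianPDF 0 1) (by fun_prop)]
  have h1 : ∀ y : ℝ, (gaussianPDF 0 1 * fun y => ENNReal.ofReal (Real.exp (y ^ 2 / 4))) y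
      = ENNReal.ofReal ((√(2 * Real.pi))⁻¹ * Real.exp (-(1 / 4) * y ^ 2)) := by
    intro y
    rw [Pi.mul_apply, gaussianPDF, ← ENNReal.ofReal_mul (gaussianPDFReal_nonneg 0 1 y),
      gaussianPDFReal, mul_assoc, ← Real.exp_add]
    norm_num
    ring_nf
  simp only [h1]
  rw [← ofReal_integral_eq_lintegral_ofReal
    ((integrable_exp_neg_mul_sq (by norm_num)).const_mul _)
    (Filter.Eventually.of_forall fun y => by positivity), integral_const_mul, integral_gaussian]
  rw [← ENNReal.ofReal_ofNat]
  refine ENNReal.ofReal_le_ofReal ?_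
  rw [inv_mul_le_iff₀ (by positivity)]
  refine Real.sqrt_le_iff.2 ⟨by positivity, ?_⟩
  rw [mul_pow, Real.sq_sqrt (by positivity)]
  nlinarith [Real.pi_pos]

/-- A subgaussian bound on exponential moments gives an exponential square moment. -/
lemma lintegral_youngM2_le_of_exp_le {μ : Measure ℝ} [IsFiniteMeasure μ] {X : ℝ → ℝ}
    (hX : Measurable X)
    (h : ∀ y : ℝ, ∫⁻ t, ENNReal.ofReal (Real.exp (X t * y)) ∂μ
      ≤ 2 * μ Set.univ * ENNReal.ofReal (Real.exp (y ^ 2 / 4))) :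
    ∫⁻ t, ENNReal.ofReal (youngM2 (|X t| / 2)) ∂μ ≤ μ Set.univ := by
  have h1 : ∫⁻ t, ENNReal.ofReal (Real.exp (X t ^ 2 / 2)) ∂μ ≤ 4 * μ Set.univ := by
    -- The square is linearized: `exp (x² / 2)` is the mean of `exp (x g)` for a standard Gaussian
    -- `g`; then Tonelli applies.
    calc ∫⁻ t, ENNReal.ofReal (Real.exp (X t ^ 2 / 2)) ∂μ
        = ∫⁻ t, ∫⁻ y, ENNReal.ofReal (Real.exp (X t * y)) ∂gaussianReal 0 1 ∂μ := by
          simp only [lintegral_exp_mul_gaussianReal]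
      _ = ∫⁻ y, ∫⁻ t, ENNReal.ofReal (Real.exp (X t * y)) ∂μ ∂gaussianReal 0 1 := by
          refine lintegral_lintegral_swap (Measurable.aemeasurable ?_)
          exact (Real.measurable_exp.comp
            ((hX.comp measurable_fst).mul measurable_snd)).ennreal_ofReal
      _ ≤ ∫⁻ y, 2 * μ Set.univ * ENNReal.ofReal (Real.exp (y ^ 2 / 4)) ∂gaussianReal 0 1 :=
          lintegral_mono h
      _ = 2 * μ Set.univ * ∫⁻ y, ENNReal.ofReal (Real.exp (y ^ 2 / 4)) ∂gaussianReal 0 1 :=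
          lintegral_const_mul _ (by fun_prop)
      _ ≤ 2 * μ Set.univ * 2 := by
          gcongr
          exact lintegral_exp_sq_gaussianReal_le
      _ = 4 * μ Set.univ := by ring
  -- With `u = exp (X² / 4)` this is `u - 1 ≤ u² / 4`, and the quarter cancels the constant 4 in
  -- `h1`.
  have h2 : ∀ t, ENNReal.ofReal (youngM2 (|X t| / 2))
      ≤ 4⁻¹ * ENNReal.ofReal (Real.exp (X t ^ 2 / 2)) := by
    intro t
    have h3 : Real.exp (X t ^ 2 / 2) = Real.exp (X t ^ 2 / 4) ^ 2 := by
      rw [← Real.exp_nat_mul]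
      congr 1
      push_cast
      ring
    have h4 : youngM2 (|X t| / 2) = Real.exp (X t ^ 2 / 4) - 1 := by
      rw [youngM2, div_pow, sq_abs]
      norm_num
    have h5 : (4⁻¹ : ℝ≥0∞) = ENNReal.ofReal 4⁻¹ := by
      rw [ENNReal.ofReal_inv_of_pos (by norm_num), ENNReal.ofReal_ofNat]
    rw [h5, ← ENNReal.ofReal_mul (by norm_num), h3, h4]
    refine ENNReal.ofReal_le_ofReal ?_
    nlinarith [sq_nonneg (Real.exp (X t ^ 2 / 4) - 2)]
  calc ∫⁻ t, ENNReal.ofReal (youngM2 (|X t| / 2)) ∂μ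
      ≤ ∫⁻ t, 4⁻¹ * ENNReal.ofReal (Real.exp (X t ^ 2 / 2)) ∂μ := lintegral_mono h2
    _ = 4⁻¹ * ∫⁻ t, ENNReal.ofReal (Real.exp (X t ^ 2 / 2)) ∂μ :=
        lintegral_const_mul' _ _ (by simp)
    _ ≤ 4⁻¹ * (4 * μ Set.univ) := by gcongr
    _ = μ Set.univ := by
        rw [← mul_assoc, ENNReal.inv_mul_cancel (by norm_num) (by norm_num), one_mul]

end Gaussian

/-! ### From finite sums to the series. -/

lemma summable_smul_walshLp {n : ℕ → ℕ} (hn : Function.Injective n) {a : ℕ → ℝ}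
    (ha : Summable fun k => a k ^ 2) : Summable fun k => a k • walshLp (n k) := by
  have ho : Orthonormal ℝ fun k => walshSetLp (bitSet (n k)) :=
    orthonormal_walshSetLp.comp _ (bitSet_injective.comp hn)
  have h := ho.orthogonalFamily.summable_iff_norm_sq_summable a
  simp only [LinearIsometry.toSpanSingleton_apply, Real.norm_eq_abs, sq_abs] at h
  exact h.2 ha

lemma coeFn_sum_smul_walshLp (n : ℕ → ℕ) (a : ℕ → ℝ) (m : ℕ) :
    ⇑(∑ k ∈ Finset.range m, a k • walshLp (n k))
      =ᵐ[unitMeasure] fun t => ∑ k ∈ Finset.range m, a k * walsh (n k) t := by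
  induction m with
  | zero =>
    simp only [Finset.range_zero, Finset.sum_empty]
    exact Lp.coeFn_zero _ _ _
  | succ m ih =>
    rw [Finset.sum_range_succ]
    filter_upwards [ih, Lp.coeFn_add (∑ k ∈ Finset.range m, a k • walshLp (n k))
      (a m • walshLp (n m)), Lp.coeFn_smul (a m) (walshLp (n m)),
      (memLp_walsh (n m)).coeFn_toLp] with t h1 h2 h3 h4
    rw [h2, Pi.add_apply, h1, h3, Pi.smul_apply, walshLp, h4, Finset.sum_range_succ, smul_eq_mul]

lemma measurable_walsh_sum (n : ℕ → ℕ) (a : ℕ → ℝ) (m : ℕ) :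
    Measurable fun t => ∑ k ∈ Finset.range m, a k * walsh (n k) t :=
  Finset.measurable_fun_sum _ fun k _ => (measurable_walsh (n k)).const_mul _

lemma restrict_unitMeasure {E : Set ℝ} (hE : MeasurableSet E) (hE1 : E ⊆ Set.Icc 0 1) :
    unitMeasure.restrict E = volume.restrict E := by
  rw [unitMeasure, Measure.restrict_restrict hE, Set.inter_eq_left.2 hE1]

lemma norm_sq_LpToLpRestrictCLM (E : Set ℝ) (f : Lp ℝ 2 unitMeasure) :
    ‖LpToLpRestrictCLM ℝ ℝ ℝ unitMeasure 2 E f‖ ^ 2 = ∫ t in E, f t ^ 2 ∂unitMeasure := by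
  rw [← real_inner_self_eq_norm_sq, L2.inner_def]
  refine integral_congr_ae ?_
  filter_upwards [LpToLpRestrictCLM_coeFn ℝ E f] with t ht
  simp [ht, sq]

/-- A lower `L²(E)` bound for partial sums passes to the sum of the series. -/
lemma le_setIntegral_sq_of_hasSum {E : Set ℝ} (hE : MeasurableSet E) (hE1 : E ⊆ Set.Icc 0 1)
    {n : ℕ → ℕ} {a : ℕ → ℝ} {f : Lp ℝ 2 unitMeasure}
    (hf : HasSum (fun k => a k • walshLp (n k)) f) (ha : Summable fun k => a k ^ 2) {C : ℝ}
    (h : ∀ m, C * ∑ k ∈ Finset.range m, a k ^ 2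
      ≤ ∫ t in E, (∑ k ∈ Finset.range m, a k * walsh (n k) t) ^ 2) :
    C * ∑' k, a k ^ 2 ≤ ∫ t in E, f t ^ 2 := by
  have h1 := ((LpToLpRestrictCLM ℝ ℝ ℝ unitMeasure 2 E).continuous.tendsto f).comp
    hf.tendsto_sum_nat
  have h2 := h1.norm.pow 2
  rw [norm_sq_LpToLpRestrictCLM] at h2
  rw [← restrict_unitMeasure hE hE1]
  refine le_of_tendsto_of_tendsto' (ha.hasSum.tendsto_sum_nat.const_mul C) h2 fun m => ?_
  simp only [Function.comp_apply]
  rw [norm_sq_LpToLpRestrictCLM]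
  refine (h m).trans_eq ?_
  rw [restrict_unitMeasure hE hE1]
  refine integral_congr_ae ?_
  have := ae_restrict_of_ae (s := E) (coeFn_sum_smul_walshLp n a m)
  rw [restrict_unitMeasure hE hE1] at this
  filter_upwards [this] with t ht
  rw [ht]

/-- An exponential square bound for a subsequence of partial sums passes to the sum of the
series. -/
lemma lintegral_youngM2_le_of_hasSum {E : Set ℝ} (hE : MeasurableSet E) (hE1 : E ⊆ Set.Icc 0 1)
    {n : ℕ → ℕ} {a : ℕ → ℝ} {f : Lp ℝ 2 unitMeasure}
    (hf : HasSum (fun k => a k • walshLp (n k)) f) {M : ℕ} (hM : 0 < M) {c : ℝ} {C : ℝ≥0∞}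
    (h : ∀ m, ∫⁻ t in E, ENNReal.ofReal
      (youngM2 (|∑ k ∈ Finset.range (M * m), a k * walsh (n k) t| / c)) ≤ C) :
    ∫⁻ t in E, ENNReal.ofReal (youngM2 (|f t| / c)) ≤ C := by
  have hlim : Filter.Tendsto (fun m => ∑ k ∈ Finset.range (M * m), a k • walshLp (n k))
      Filter.atTop (nhds f) :=
    hf.tendsto_sum_nat.comp (Filter.tendsto_id.const_mul_atTop' hM)
  -- `L²` convergence gives almost everywhere convergence along a subsequence, which is enough for
  -- Fatou.
  obtain ⟨ns, -, hns⟩ := (tendstoInMeasure_of_tendsto_Lp hlim).exists_seq_tendsto_ae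
  have hcoe : ∀ᵐ t ∂unitMeasure, ∀ m, (∑ k ∈ Finset.range (M * m), a k • walshLp (n k) :
      Lp ℝ 2 unitMeasure) t = ∑ k ∈ Finset.range (M * m), a k * walsh (n k) t :=
    ae_all_iff.2 fun m => coeFn_sum_smul_walshLp n a (M * m)
  have hae : ∀ᵐ t ∂volume.restrict E, Filter.Tendsto
      (fun i => ENNReal.ofReal
        (youngM2 (|∑ k ∈ Finset.range (M * ns i), a k * walsh (n k) t| / c)))
      Filter.atTop (nhds (ENNReal.ofReal (youngM2 (|f t| / c)))) := by
    rw [← restrict_unitMeasure hE hE1]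
    refine ae_restrict_of_ae ?_
    filter_upwards [hns, hcoe] with t h1 h2
    simp only [h2] at h1
    have hcont : Continuous fun x : ℝ => ENNReal.ofReal (youngM2 (|x| / c)) := by
      unfold youngM2
      exact ENNReal.continuous_ofReal.comp (by fun_prop)
    exact (hcont.tendsto _).comp h1
  calc ∫⁻ t in E, ENNReal.ofReal (youngM2 (|f t| / c))
      = ∫⁻ t in E, Filter.liminf (fun i => ENNReal.ofReal
        (youngM2 (|∑ k ∈ Finset.range (M * ns i), a k * walsh (n k) t| / c))) Filter.atTop := by
        refine lintegral_congr_ae ?_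
        filter_upwards [hae] with t ht using ht.liminf_eq.symm
    _ ≤ Filter.liminf (fun i => ∫⁻ t in E, ENNReal.ofReal
        (youngM2 (|∑ k ∈ Finset.range (M * ns i), a k * walsh (n k) t| / c))) Filter.atTop :=
        lintegral_liminf_le fun i =>
          measurable_ofReal_youngM2 (measurable_walsh_sum n a (M * ns i)) c
    _ ≤ C := Filter.liminf_le_of_le (by isBoundedDefault) fun b hb => by
        obtain ⟨i, hi⟩ := hb.exists
        exact hi.trans (h _)

/-- Exponential square integrability over `E` of finite lacunary Walsh sums. -/
lemma IsLacunary.lintegral_youngM2_le {q : ℝ} {n : ℕ → ℕ} (hq : 1 < q) (h : IsLacunary q n)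
    {M L : ℕ} (hM0 : 0 < M) (hM : 2 ≤ q ^ M) (hN : ∀ k, 2 ^ L ≤ n k)
    {E : Set ℝ} [IsFiniteMeasure (volume.restrict E)] {δ : ℝ}
    (hc : ∀ F : Finset (Finset ℕ), (∀ I ∈ F, ∃ i ∈ I, L ≤ i) →
      ∑ I ∈ F, (∫ t in E, walshSet I t) ^ 2 ≤ δ)
    (hδ : δ ≤ volume.real E ^ 2) {a : ℕ → ℝ} {s : ℝ} (hs : 0 < s)
    (ha : ∀ m, ∑ k ∈ Finset.range m, a k ^ 2 ≤ s ^ 2) (m : ℕ) :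
    ∫⁻ t in E, ENNReal.ofReal (youngM2
      (|∑ k ∈ Finset.range (M * m), a k * walsh (n k) t| / (4 * M * s))) ≤ volume E := by
  have hMR : (0 : ℝ) < M := by exact_mod_cast hM0
  -- Dividing by `2 M s` turns the exponent `M ^ 2 ∑ b_k²` into at most `y ^ 2 / 4`; the Gaussian
  -- step contributes the remaining factor 2 of `4 M s`.
  set X : ℝ → ℝ := fun t => (∑ k ∈ Finset.range (M * m), a k * walsh (n k) t) / (2 * M * s)
    with hXdef
  have hX : Measurable X := (measurable_walsh_sum n a _).div_const _
  have hfin : volume E ≠ ∞ := by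
    simpa using measure_ne_top (volume.restrict E) Set.univ
  have key := lintegral_youngM2_le_of_exp_le (μ := volume.restrict E) hX ?_
  · rw [Measure.restrict_apply_univ] at key
    refine le_of_eq_of_le (lintegral_congr fun t => ?_) key
    rw [hXdef, abs_div, abs_of_pos (by positivity : 0 < 2 * M * s), div_div,
      show 4 * (M : ℝ) * s = 2 * M * s * 2 by ring]
  intro y
  set b : ℕ → ℝ := fun k => a k * (y / (2 * M * s)) with hb
  have hXy : ∀ t, X t * y = ∑ k ∈ Finset.range (M * m), b k * walsh (n k) t := by
    intro t
    rw [hXdef, hb, div_mul_eq_mul_div, mul_div_assoc, Finset.sum_mul]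
    exact Finset.sum_congr rfl fun k _ => by ring
  have hb2 : ∀ m, ∑ k ∈ Finset.range m, b k ^ 2 ≤ y ^ 2 / (4 * M ^ 2) := by
    intro m
    simp only [hb, mul_pow]
    rw [← Finset.sum_mul]
    calc _ ≤ s ^ 2 * (y / (2 * M * s)) ^ 2 := by gcongr; exact ha m
      _ = _ := by field_simp; ring
  have hle := h.setIntegral_exp_le hq hM0 hM hN hc hδ b hb2 m
  simp only [hXy]
  have hbd : ∀ t, |∑ k ∈ Finset.range (M * m), b k * walsh (n k) t|
      ≤ ∑ k ∈ Finset.range (M * m), |b k| := by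
    intro t
    refine (Finset.abs_sum_le_sum_abs _ _).trans (Finset.sum_le_sum fun k _ => ?_)
    rw [abs_mul]
    exact mul_le_of_le_one_right (abs_nonneg _) (abs_walsh_le_one _ _)
  rw [← ofReal_integral_eq_lintegral_ofReal (integrable_of_abs_le
    (measurable_walsh_sum n b _).exp (C := Real.exp (∑ k ∈ Finset.range (M * m), |b k|))
      fun t => by
        rw [Real.abs_exp]
        exact Real.exp_le_exp.2 ((le_abs_self _).trans (hbd t)))
    (Filter.Eventually.of_forall fun t => (Real.exp_pos _).le)]
  refine (ENNReal.ofReal_le_ofReal hle).trans_eq ?_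
  rw [ENNReal.ofReal_mul (by positivity), ENNReal.ofReal_mul (by norm_num), ENNReal.ofReal_ofNat,
    Measure.real, ENNReal.ofReal_toReal hfin, Measure.restrict_apply_univ]
  congr 3
  field_simp

/-! ### Choice of constants and conclusion. -/

theorem theorem3p1 (q : ℝ) (hq : 1 < q) :
    ∃ A B : ℝ, 0 < A ∧ 0 < B ∧
      ∀ E : Set ℝ, E ⊆ Set.Icc 0 1 → NullMeasurableSet E volume → 0 < volume E →
        ∃ N : ℕ, ∀ n : ℕ → ℕ, IsLacunary q n → (∀ k, N ≤ n k) →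
          ∀ a : ℕ → ℝ, Summable (fun k => a k ^ 2) →
            ∃ f : Lp ℝ 2 unitMeasure, HasSum (fun k => a k • walshLp (n k)) f ∧
              ENNReal.ofReal (A * √(∑' k, a k ^ 2)) ≤ localNorm (orliczNorm youngM2) E f ∧
              localNorm (orliczNorm youngM2) E f ≤ ENNReal.ofReal (B * √(∑' k, a k ^ 2)) := by
  have hq1 : 0 < q - 1 := by linarith
  obtain ⟨M, hM'⟩ := pow_unbounded_of_one_lt (2 * q / (q - 1)) hq
  have hM : 2 * q ≤ (q - 1) * q ^ M := by
    rw [div_lt_iff₀ hq1] at hM'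
    linarith
  have hM0 : 0 < M := by
    rcases Nat.eq_zero_or_pos M with rfl | h
    · norm_num at hM
      linarith
    · exact h
  have hMR : (0 : ℝ) < M := by exact_mod_cast hM0
  have hM2 : 2 ≤ q ^ M := by
    by_contra! hlt
    nlinarith
  refine ⟨1 / 2, 4 * M, by norm_num, by positivity, fun E₀ hE₀1 hE₀ hpos => ?_⟩
  -- The estimates are proved on a measurable `E` of full measure in `E₀`; the local norm keeps
  -- `E₀`, since only integrals over it enter.
  obtain ⟨E, hEE, hE, hEae⟩ := hE₀.exists_measurable_subset_ae_eq
  have hE1 : E ⊆ Set.Icc 0 1 := hEE.trans hE₀1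
  have hres : volume.restrict E₀ = volume.restrict E := (Measure.restrict_congr_set hEae).symm
  have hvol : volume E₀ = volume E := (measure_congr hEae).symm
  have hfin : volume E < ∞ := (measure_mono hE1).trans_lt measure_Icc_lt_top
  have : IsFiniteMeasure (volume.restrict E) := ⟨by simpa using hfin⟩
  have hvpos : 0 < volume.real E := ENNReal.toReal_pos (hvol ▸ hpos.ne') hfin.ne
  have hvpos₀ : 0 < volume.real E₀ := by rwa [Measure.real, hvol]
  set δ := volume.real E ^ 2 / (16 * M) with hδdef
  have hδ : 0 < δ := by positivity
  have hδ1 : 16 * M * δ ≤ volume.real E ^ 2 := by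
    rw [hδdef]
    field_simp
    exact le_rfl
  have hδ2 : δ ≤ volume.real E ^ 2 := by
    have : (1 : ℝ) ≤ M := by exact_mod_cast hM0
    nlinarith
  obtain ⟨L, hL⟩ := exists_walsh_tail hE hE1 hδ
  -- This threshold puts a position at least `L` in every symmetric difference, and also yields `2 ^
  -- L ≤ n k`.
  refine ⟨⌈2 ^ L * q / (q - 1)⌉₊, fun n hn hN a ha => ?_⟩
  have hN1 : ∀ k, (2 : ℝ) ^ L * q ≤ (q - 1) * n k := fun k => by
    have := Nat.ceil_le.1 (hN k)
    rw [div_le_iff₀ hq1] at this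
    linarith
  have hN2 : ∀ k, 2 ^ L ≤ n k := fun k => by
    have h1 : (q - 1) * 2 ^ L ≤ (q - 1) * n k := by
      have h2 : (0 : ℝ) < 2 ^ L := by positivity
      linarith [hN1 k]
    exact_mod_cast le_of_mul_le_mul_left h1 hq1
  obtain ⟨f, hf⟩ := summable_smul_walshLp (hn.strictMono hq).injective ha
  have hfm : Measurable f := (Lp.stronglyMeasurable f).measurable
  set σ := ∑' k, a k ^ 2 with hσ
  have hσ0 : 0 ≤ σ := tsum_nonneg fun _ => sq_nonneg _
  refine ⟨f, hf, ?_, ?_⟩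
  · refine le_localNorm_youngM2 hE₀1 hvpos₀ hfm ?_
    rw [hres, hvol]
    have h1 := le_setIntegral_sq_of_hasSum hE hE1 hf ha
      (hn.le_setIntegral_sq hq hM0 hM hN1 hL hδ1 a)
    have h2 : Integrable (fun t => f t ^ 2) (volume.restrict E) := by
      rw [← restrict_unitMeasure hE hE1]
      exact ((Lp.memLp f).integrable_sq).restrict
    rw [← ofReal_integral_eq_lintegral_ofReal h2 (Filter.Eventually.of_forall fun t => sq_nonneg _)]
    rw [← ENNReal.ofReal_toReal hfin.ne, ← ENNReal.ofReal_mul (sq_nonneg _)]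
    refine ENNReal.ofReal_le_ofReal (le_trans ?_ h1)
    rw [mul_pow, Real.sq_sqrt hσ0]
    change _ * volume.real E ≤ _
    nlinarith [mul_nonneg hvpos.le hσ0]
  · have key : ∀ s : ℝ, 0 < s → σ ≤ s ^ 2 →
        localNorm (orliczNorm youngM2) E₀ f ≤ ENNReal.ofReal (4 * M * s) := by
      intro s hs hσs
      refine localNorm_youngM2_le hE₀1 hvpos₀ hfm (by positivity) ?_
      rw [hres, hvol]
      exact lintegral_youngM2_le_of_hasSum hE hE1 hf hM0
        (hn.lintegral_youngM2_le hq hM0 hM2 hN2 hL hδ2 hs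
          fun m => (ha.sum_le_tsum _ fun _ _ => sq_nonneg _).trans hσs)
    -- Admissible scales must be positive, so `σ = 0` is reached by letting `s` tend to 0.
    rcases hσ0.eq_or_lt with h | h
    · rw [← h, Real.sqrt_zero, mul_zero, ENNReal.ofReal_zero]
      refine ENNReal.le_of_forall_pos_le_add fun ε hε _ => ?_
      rw [zero_add]
      refine (key (ε / (4 * M)) (by positivity) (h ▸ sq_nonneg _)).trans_eq ?_
      rw [mul_div_cancel₀ _ (by positivity), ENNReal.ofReal_coe_nnreal]
    · exact key _ (Real.sqrt_pos.2 h) (Real.sq_sqrt hσ0).ge
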